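/- Let $m\ge 2$ and $s\ge 1$ be integers, let $X=\{0,\dots,m-1\}$, and let $T$ be the $m$-regular rooted tree, whose vertices are the finite words over $X$. For $g\in\mathrm{Aut}(T)$ and a vertex $u$, the section $g|_u\in\mathrm{Aut}(T)$ is defined by $g(uv)=g(u)\,g|_u(v)$, and the label $g|^u\in\mathrm{Sym}(X)$ is the restriction of $g|_u$ to $X$. Write $g=\tau(g_0,\dots,g_{m-1})$ if $g|^\epsilon=\tau$ at the empty word $\epsilon$ and $g|_x=g_x$ for all $x\in X$. Let $\Gamma\le\mathrm{Aut}(T)$ be the subgroup of all automorphisms whose labels all lie in $\langle\sigma\rangle$, where $\sigma=(0\;1\;\dots\;m-1)$. For $G\le\mathrm{Aut}(T)$, let $\mathrm{St}_G(n)$ be the subgroup of all elements of $G$ that fix every word of length $n$. The homomorphisms $\beta_i\colon\mathrm{Aut}(T)\to\mathrm{Aut}(T)$, $0\le i\le s-1$, are defined by $$\beta_i(g)=(\beta_{i-1}(g),\mathrm{id},\dots,\mathrm{id})\ \ (1\le i\le s-1),\qquad \beta_0(g)=g|^\epsilon\,(\beta_{s-1}(g|_0),\dots,\beta_{s-1}(g|_{m-1})),$$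 and the $s$-th Basilica group of $G$ is $\mathrm{Bas}_s(G)=\langle\beta_i(g)\mid g\in G,\ 0\le i\le s-1\rangle$. Let $N_{s-1}$ be the normal closure of $\langle\beta_j(G)\mid 0\le j<s-1\rangle$ in $\mathrm{Bas}_s(G)$, and let $K_{s-1}=\beta_{s-1}^{-1}(\beta_{s-1}(G)\cap N_{s-1})$ be the $(s-1)$-th splitting kernel of $G$. The series of obstructions of a group $G\le\Gamma$ is defined by $o_G(0)=-1$ and $$o_G(n)=\log_m\bigl(|L_G(n-1)|^m\bigr)-\log_m|L_G(n)|\quad(n\ge 1),\qquad L_G(n)=\mathrm{St}_G(n)/\mathrm{St}_G(n+1).$$ Let $G\le\Gamma$ be such that * $G$ is self-similar: $g|_v\in G$ for all $g\in G$ and all vertices $v$; * $G$ is very strongly fractal: $G$ acts transitively on the words of each length, and $\{g|_x\mid g\in\mathrm{St}_G(n+1)\}=\mathrm{St}_G(n)$ for all $n\ge 0$ and $x\in X$; * $G$ is weakly regular branch over $K_{s-1}$: for all $k_0,\dots,k_{m-1}\in K_{s-1}$ there is a $k\in \mathrm{St}_{K_{s-1}}(1)$ with $k|_x=k_x$ for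 all $x\in X$ (here $K_{s-1}$ may be trivial). Then the series of obstructions of $B=\mathrm{Bas}_s(G)$ satisfies, for every $n\ge 0$, $$o_B(n)=\begin{cases}0&\text{if } s\nmid n,\\ o_G(n/s)&\text{if } s\mid n.\end{cases}$$ -/

import Mathlib

namespace Basilica

/-- The automorphism group of the `m`-regular rooted tree `T`. The vertices are the finite words
over `X = Fin m`, the root is the empty word, and `v` lies in the subtree rooted at `u` iff `u` is
a prefix of `v`. An automorphism is a bijection of the vertices that preserves the layers and the
prefix relation. It acts from the left, and `a * b` means first `b`, then `a`. -/
def treeAut (m : ℕ) : Subgroup (Equiv.Perm (List (Fin m))) where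
  carrier := {g | (∀ u, (g u).length = u.length) ∧ ∀ u v, g u <+: g (u ++ v)}
  one_mem' := ⟨fun _ => rfl, fun u v => List.prefix_append u v⟩
  mul_mem' := by
    rintro a b ⟨ha, ha'⟩ ⟨hb, hb'⟩
    refine ⟨fun u => by simp [ha, hb], fun u v => ?_⟩
    obtain ⟨w, hw⟩ := hb' u v
    simpa [← hw] using ha' (b u) w
  inv_mem' := by
    rintro g ⟨hg, hg'⟩
    have hl : ∀ u, (g⁻¹ u).length = u.length := fun u => by
      have h := hg (g⁻¹ u)
      rw [show g (g⁻¹ u) = u from Equiv.apply_symm_apply g u] at h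
      exact h.symm
    refine ⟨hl, fun u v => ?_⟩
    have h1 := hg' ((g⁻¹ (u ++ v)).take u.length) ((g⁻¹ (u ++ v)).drop u.length)
    rw [List.take_append_drop, show g (g⁻¹ (u ++ v)) = u ++ v from Equiv.apply_symm_apply g _] at h1
    have h2 : g ((g⁻¹ (u ++ v)).take u.length) = u := by
      have h3 := List.prefix_of_prefix_length_le h1 (List.prefix_append u v)
        (by rw [hg]; exact List.length_take_le _ _)
      exact h3.eq_of_length (by
        rw [hg, List.length_take, hl]
        simp)
    have h4 : g⁻¹ u = (g⁻¹ (u ++ v)).take u.length := by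
      rw [Equiv.Perm.inv_eq_iff_eq]; exact h2.symm
    rw [h4]
    exact List.take_prefix _ _

/-- `Aut(T)` as a type. -/
abbrev Aut (m : ℕ) : Type := treeAut m

variable {m : ℕ}

theorem length_apply (g : Aut m) (u : List (Fin m)) : (g.1 u).length = u.length := g.2.1 u

theorem apply_append (g : Aut m) (u v : List (Fin m)) :
    g.1 (u ++ v) = g.1 u ++ (g.1 (u ++ v)).drop u.length := by
  obtain ⟨w, hw⟩ := g.2.2 u v
  rw [← hw, ← length_apply g u, List.drop_left]

theorem inv_apply_append_drop (g : Aut m) (u v : List (Fin m)) :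
    ((g⁻¹).1 (g.1 u ++ (g.1 (u ++ v)).drop u.length)).drop u.length = v := by
  rw [← apply_append]
  have h : (g⁻¹).1 (g.1 (u ++ v)) = u ++ v := Equiv.symm_apply_apply g.1 (u ++ v)
  rw [h, List.drop_left]

/-- The section `g|_u`: the automorphism of `T` with `g (u v) = g(u) (g|_u)(v)` for all `v`
(see `apply_append_eq`). -/
def sect (g : Aut m) (u : List (Fin m)) : Aut m where
  val :=
    { toFun := fun v => (g.1 (u ++ v)).drop u.length
      invFun := fun v => ((g⁻¹).1 (g.1 u ++ v)).drop u.length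
      left_inv := fun v => inv_apply_append_drop g u v
      right_inv := fun v => by
        have h := inv_apply_append_drop g⁻¹ (g.1 u) v
        have h1 : (g⁻¹).1 (g.1 u) = u := Equiv.symm_apply_apply g.1 u
        rw [h1, length_apply, inv_inv] at h
        exact h }
  property := by
    refine ⟨fun v => ?_, fun v w => ?_⟩
    · change ((g.1 (u ++ v)).drop u.length).length = v.length
      simp [length_apply]
    · change (g.1 (u ++ v)).drop u.length <+: (g.1 (u ++ (v ++ w))).drop u.length
      rw [← List.append_assoc]
      exact (g.2.2 (u ++ v) w).drop u.length

theorem apply_append_eq (g : Aut m) (u v : List (Fin m)) :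
    g.1 (u ++ v) = g.1 u ++ (sect g u).1 v := apply_append g u v

theorem sect_mul (g h : Aut m) (u : List (Fin m)) :
    sect (g * h) u = sect g (h.1 u) * sect h u := by
  apply Subtype.ext
  apply Equiv.ext
  intro v
  have h1 := apply_append_eq (g * h) u v
  have h2 := apply_append_eq h u v
  have h3 := apply_append_eq g (h.1 u) ((sect h u).1 v)
  have h4 : (g * h).1 (u ++ v) = g.1 (h.1 (u ++ v)) := rfl
  rw [h4, h2, h3] at h1
  exact (List.append_cancel_left h1).symm

theorem sect_one (u : List (Fin m)) : sect (1 : Aut m) u = 1 := by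
  apply Subtype.ext
  apply Equiv.ext
  intro v
  exact (List.append_cancel_left (apply_append_eq (1 : Aut m) u v)).symm

/-- The image of the letter `x` under the action of `g` on the first layer. -/
def letter (g : Aut m) (x : Fin m) : Fin m :=
  (g.1 [x]).head (by
    have h := length_apply g [x]
    intro h0
    simp [h0] at h)

theorem apply_singleton (g : Aut m) (x : Fin m) : g.1 [x] = [letter g x] := by
  obtain ⟨y, hy⟩ := List.length_eq_one_iff.mp (length_apply g [x])
  simp [letter, hy]

theorem letter_mul (g h : Aut m) (x : Fin m) : letter (g * h) x = letter g (letter h x) := by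
  have h1 := apply_singleton (g * h) x
  have h2 : (g * h).1 [x] = g.1 (h.1 [x]) := rfl
  rw [h2, apply_singleton h, apply_singleton g] at h1
  exact (List.singleton_injective h1).symm

theorem letter_one (x : Fin m) : letter (1 : Aut m) x = x :=
  (List.singleton_injective (apply_singleton (1 : Aut m) x)).symm

/-- The label `g|^u`: the permutation of `X` that the section `g|_u` induces on the first layer. -/
def label (g : Aut m) (u : List (Fin m)) : Equiv.Perm (Fin m) where
  toFun x := letter (sect g u) x
  invFun x := letter (sect g u)⁻¹ x
  left_inv x := by beta_reduce; rw [← letter_mul, inv_mul_cancel, letter_one]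
  right_inv x := by beta_reduce; rw [← letter_mul, mul_inv_cancel, letter_one]

theorem sect_nil (g : Aut m) : sect g [] = g := by
  apply Subtype.ext
  apply Equiv.ext
  intro v
  rfl

/-- The action of `β_i^s(g)` on words, for `i < s`:
`β_i^s(g) = (β_{i-1}^s(g), id, …, id)` for `1 ≤ i`, and
`β_0^s(g) = g|^ε (β_{s-1}^s(g|_0), …, β_{s-1}^s(g|_{m-1}))`. -/
def betaFun (s : ℕ) : ℕ → Aut m → List (Fin m) → List (Fin m)
  | _, _, [] => []
  | 0, g, x :: w => label g [] x :: betaFun s (s - 1) (sect g [x]) w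
  | i + 1, g, x :: w => if (x : ℕ) = 0 then x :: betaFun s i g w else x :: w

theorem betaFun_mul (s : ℕ) (w : List (Fin m)) : ∀ (i : ℕ) (g h : Aut m),
    betaFun s i (g * h) w = betaFun s i g (betaFun s i h w) := by
  induction w with
  | nil => intro i g h; simp [betaFun]
  | cons x w ih =>
    rintro (_ | i) g h
    · have h1 : h.1 [x] = [label h [] x] := by
        rw [apply_singleton]
        change _ = [letter (sect h []) x]
        rw [sect_nil]
      have h2 : label (g * h) [] x = label g [] (label h [] x) := by
        change letter (sect (g * h) []) x = letter (sect g []) (letter (sect h []) x)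
        simp only [sect_nil, letter_mul]
      simp only [betaFun, sect_mul, ih, h1, h2]
    · by_cases hx : (x : ℕ) = 0
      · simp [betaFun, hx, ih]
      · simp [betaFun, hx]

theorem betaFun_one (s : ℕ) (w : List (Fin m)) : ∀ i : ℕ,
    betaFun s i (1 : Aut m) w = w := by
  induction w with
  | nil => intro i; simp [betaFun]
  | cons x w ih =>
    rintro (_ | i)
    · have h2 : label (1 : Aut m) [] x = x := by
        change letter (sect (1 : Aut m) []) x = x
        rw [sect_nil, letter_one]
      simp only [betaFun, sect_one, ih, h2]
    · simp [betaFun, ih]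

theorem betaFun_length (s : ℕ) (w : List (Fin m)) : ∀ (i : ℕ) (g : Aut m),
    (betaFun s i g w).length = w.length := by
  induction w with
  | nil => intro i g; simp [betaFun]
  | cons x w ih =>
    rintro (_ | i) g
    · simp [betaFun, ih]
    · by_cases hx : (x : ℕ) = 0 <;> simp [betaFun, hx, ih]

theorem betaFun_prefix (s : ℕ) (u v : List (Fin m)) : ∀ (i : ℕ) (g : Aut m),
    betaFun s i g u <+: betaFun s i g (u ++ v) := by
  induction u with
  | nil => intro i g; simp [betaFun]
  | cons x w ih =>
    rintro (_ | i) g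
    · simp [betaFun, ih]
    · by_cases hx : (x : ℕ) = 0 <;> simp [betaFun, hx, ih]

/-- The homomorphism `β_i^s : Aut(T) → Aut(T)`, for `i < s`. -/
def beta (m s i : ℕ) : Aut m →* Aut m where
  toFun g :=
    ⟨{ toFun := betaFun s i g
       invFun := betaFun s i g⁻¹
       left_inv := fun w => by rw [← betaFun_mul, inv_mul_cancel, betaFun_one]
       right_inv := fun w => by rw [← betaFun_mul, mul_inv_cancel, betaFun_one] },
      fun u => betaFun_length s u i g, fun u v => betaFun_prefix s u v i g⟩
  map_one' := Subtype.ext (Equiv.ext fun w => betaFun_one s w i)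
  map_mul' g h := Subtype.ext (Equiv.ext fun w => betaFun_mul s w i g h)

/-- The `s`-th Basilica group `Bas_s(G)`. -/
def basilica (s : ℕ) (G : Subgroup (Aut m)) : Subgroup (Aut m) :=
  Subgroup.closure {b | ∃ i < s, ∃ g ∈ G, b = beta m s i g}

/-- `S_i = ⟨β_j(G) | j ≠ i⟩`. -/
def splitS (s i : ℕ) (G : Subgroup (Aut m)) : Subgroup (Aut m) :=
  Subgroup.closure {b | ∃ j < s, j ≠ i ∧ ∃ g ∈ G, b = beta m s j g}

/-- `N_i`, the normal closure of `S_i` in `Bas_s(G)`. -/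
def splitN (s i : ℕ) (G : Subgroup (Aut m)) : Subgroup (Aut m) :=
  (Subgroup.normalClosure {b : basilica s G | (b : Aut m) ∈ splitS s i G}).map
    (basilica s G).subtype

/-- The `i`-th splitting kernel `K_i = β_i⁻¹(β_i(G) ∩ N_i)` of `G`. -/
def splittingKernel (s i : ℕ) (G : Subgroup (Aut m)) : Subgroup (Aut m) :=
  (G.map (beta m s i) ⊓ splitN s i G).comap (beta m s i)

/-- `Γ(H)`, generated by the automorphisms all of whose labels lie in `H ≤ Sym(X)`. -/
def GammaOf (H : Subgroup (Equiv.Perm (Fin m))) : Subgroup (Aut m) :=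
  Subgroup.closure {a | ∀ u, label a u ∈ H}

/-- `Γ = Γ(⟨σ⟩)` for the `m`-cycle `σ = (0 1 … m-1)`. -/
def Gamma (m : ℕ) : Subgroup (Aut m) := GammaOf (Subgroup.zpowers (finRotate m))

/-- The `n`-th layer stabiliser `St_G(n)`. -/
def layerStab (G : Subgroup (Aut m)) (n : ℕ) : Subgroup (Aut m) where
  carrier := {g | g ∈ G ∧ ∀ u : List (Fin m), u.length = n → g.1 u = u}
  one_mem' := ⟨G.one_mem, fun _ _ => rfl⟩
  mul_mem' := by
    rintro a b ⟨ha, ha'⟩ ⟨hb, hb'⟩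
    refine ⟨G.mul_mem ha hb, fun u hu => ?_⟩
    change a.1 (b.1 u) = u
    rw [hb' u hu, ha' u hu]
  inv_mem' := by
    rintro a ⟨ha, ha'⟩
    refine ⟨G.inv_mem ha, fun u hu => ?_⟩
    change (a.1)⁻¹ u = u
    rw [Equiv.Perm.inv_eq_iff_eq, ha' u hu]

def SelfSimilar (G : Subgroup (Aut m)) : Prop :=
  ∀ g ∈ G, ∀ v : List (Fin m), sect g v ∈ G

def SphericallyTransitive (G : Subgroup (Aut m)) : Prop :=
  ∀ u v : List (Fin m), u.length = v.length → ∃ g ∈ G, g.1 u = v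

/-- `G` acts spherically transitively and `St_G(n+1)|_x = St_G(n)` for all `n` and `x ∈ X`. -/
def VeryStronglyFractal (G : Subgroup (Aut m)) : Prop :=
  SphericallyTransitive G ∧ ∀ (n : ℕ) (x : Fin m),
    (fun g : Aut m => sect g [x]) '' (layerStab G (n + 1) : Set (Aut m)) = layerStab G n

/-- `G` is weakly regular branch over its subgroup `H` if `H × ⋯ × H ≤ ψ_1(St_H(1))`, where `ψ_1`
sends an element of the first layer stabiliser to the tuple of its sections at the letters. -/
def WeaklyRegularBranchOver (G H : Subgroup (Aut m)) : Prop :=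
  H ≤ G ∧ ∀ h : Fin m → Aut m, (∀ x, h x ∈ H) → ∃ k ∈ layerStab H 1, ∀ x, sect k [x] = h x

/-- `L_G(n) = St_G(n) / St_G(n+1)`. -/
abbrev layerQuotient (G : Subgroup (Aut m)) (n : ℕ) : Type :=
  layerStab G n ⧸ (layerStab G (n + 1)).subgroupOf (layerStab G n)

/-- The series of obstructions: `o_G(0) = -1` and
`o_G(n) = log_m(|L_G(n-1)|^m) - log_m |L_G(n)|` for `n > 0`. -/
noncomputable def obstruction (G : Subgroup (Aut m)) : ℕ → ℝ
  | 0 => -1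
  | n + 1 => Real.logb m ((Nat.card (layerQuotient G n) : ℝ) ^ m)
      - Real.logb m (Nat.card (layerQuotient G (n + 1)))

end Basilica

namespace Basilica

variable {m : ℕ}

/-! ### Tree automorphisms and tuples of sections -/

/-! Write B for Bas_s(G) and St(n) for the full layer stabiliser in Aut(T). For self-similar G the
number o_G(n+1) is log_m of the index of St_G(n+1)·St(n+2) relative to the group of tuples St_G(n)^m
(`obstruction_succ`). So it suffices to compare such tuples for B and for G.

The main point is that St_B(n) is the normal closure in B of those β_j(St_G(k)) with sk+j ≥ n
(`layerStab_basilica_le`). Modulo an error f, an element of this closure is β_{s-1}(g) with g ∈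
St_G(⌊n/s⌋); the error lies in N_{s-1}, and (f, 1, …, 1) lies in the closure for n+1
(`exists_of_mem_stabClosure`). For b in St_B(n+1), the sections thus give a tuple of elements of G.
Modulo K_{s-1} it agrees with the sections of one element of G, so branching over K_{s-1} makes it
an element of G. Hence b is the β_0 of that element times a tuple of errors, and both factors lie in
the closure for n+1.

Consequently β_0(St_G(⌊n/s⌋)^m) represents all cosets counted by o_B(n+1). These elements fix level
s(⌊n/s⌋+1) ≥ n+1. If s does not divide n+1, they fix level n+2 and the index is 1. If n+1 = s(k+1),
then β_0 matches the cosets for B with those for G at level k+1 (`beta_zero_mem_stabExtended_iff`).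
-/

theorem apply_cons (g : Aut m) (x : Fin m) (w : List (Fin m)) :
    g.1 (x :: w) = letter g x :: (sect g [x]).1 w := by
  have h := apply_append_eq g [x] w
  rwa [apply_singleton] at h

theorem aut_ext {g h : Aut m} (h1 : ∀ x, letter g x = letter h x)
    (h2 : ∀ x, sect g [x] = sect h [x]) : g = h := by
  apply Subtype.ext
  apply Equiv.ext
  rintro (_ | ⟨x, w⟩)
  · rw [List.eq_nil_of_length_eq_zero (length_apply g []),
      List.eq_nil_of_length_eq_zero (length_apply h [])]
  · rw [apply_cons, apply_cons, h1, h2]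

theorem letter_of_apply_cons {g : Aut m} {x y : Fin m} {w v : List (Fin m)}
    (h : g.1 (x :: w) = y :: v) : letter g x = y := by
  rw [apply_cons] at h
  exact (List.cons.inj h).1

theorem sect_of_apply_cons {g h : Aut m} {x y : Fin m}
    (H : ∀ w, g.1 (x :: w) = y :: h.1 w) : sect g [x] = h := by
  apply Subtype.ext
  apply Equiv.ext
  intro w
  have h := H w
  rw [apply_cons] at h
  exact (List.cons.inj h).2

theorem sect_mul_singleton (g h : Aut m) (x : Fin m) :
    sect (g * h) [x] = sect g [letter h x] * sect h [x] := by
  rw [sect_mul, apply_singleton]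

theorem letter_inv_letter (g : Aut m) (x : Fin m) : letter g (letter g⁻¹ x) = x := by
  rw [← letter_mul, mul_inv_cancel, letter_one]

theorem letter_inv_of_eq {g : Aut m} {x y : Fin m} (h : letter g x = y) :
    letter g⁻¹ y = x := by
  rw [← h, ← letter_mul, inv_mul_cancel, letter_one]

theorem sect_inv_singleton (g : Aut m) (x : Fin m) :
    sect g⁻¹ [x] = (sect g [letter g⁻¹ x])⁻¹ := by
  have h := sect_mul_singleton g g⁻¹ x
  rw [mul_inv_cancel, sect_one] at h
  exact eq_inv_of_mul_eq_one_right h.symm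

/-- The action of the tuple `(y_0, …, y_{m-1})` on words. -/
def tupleFun (y : Fin m → Aut m) : List (Fin m) → List (Fin m)
  | [] => []
  | x :: w => x :: (y x).1 w

theorem tupleFun_mul (y z : Fin m → Aut m) (w : List (Fin m)) :
    tupleFun (y * z) w = tupleFun y (tupleFun z w) := by
  cases w <;> rfl

theorem tupleFun_one (w : List (Fin m)) : tupleFun (1 : Fin m → Aut m) w = w := by
  cases w <;> rfl

/-- The automorphism `(y_0, …, y_{m-1})` with trivial label at the root and sections `y_x`. -/
def ofTuple (m : ℕ) : (Fin m → Aut m) →* Aut m where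
  toFun y :=
    ⟨{ toFun := tupleFun y
       invFun := tupleFun y⁻¹
       left_inv := fun w => by rw [← tupleFun_mul, inv_mul_cancel, tupleFun_one]
       right_inv := fun w => by rw [← tupleFun_mul, mul_inv_cancel, tupleFun_one] },
      fun u => by cases u <;> simp [tupleFun, length_apply],
      fun u v => by
        cases u with
        | nil => exact List.nil_prefix
        | cons x u => exact (List.prefix_cons_inj x).2 ((y x).2.2 u v)⟩
  map_one' := Subtype.ext (Equiv.ext tupleFun_one)
  map_mul' y z := Subtype.ext (Equiv.ext (tupleFun_mul y z))

@[simp] theorem letter_ofTuple (y : Fin m → Aut m) (x : Fin m) : letter (ofTuple m y) x = x :=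
  letter_of_apply_cons (w := []) (v := (y x).1 []) rfl

@[simp] theorem sect_ofTuple (y : Fin m → Aut m) (x : Fin m) : sect (ofTuple m y) [x] = y x :=
  sect_of_apply_cons (y := x) fun _ => rfl

theorem eq_ofTuple {g : Aut m} {y : Fin m → Aut m} (h1 : ∀ x, letter g x = x)
    (h2 : ∀ x, sect g [x] = y x) : g = ofTuple m y :=
  aut_ext (fun x => by rw [h1, letter_ofTuple]) (fun x => by rw [h2, sect_ofTuple])

theorem conj_ofTuple_mulSingle (c e : Aut m) (x : Fin m) :
    c * ofTuple m (Pi.mulSingle x e) * c⁻¹ =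
      ofTuple m (Pi.mulSingle (letter c x) (sect c [x] * e * (sect c [x])⁻¹)) := by
  refine eq_ofTuple (fun y => ?_) fun y => ?_
  · rw [letter_mul, letter_mul, letter_ofTuple, letter_inv_letter]
  · rw [sect_mul_singleton, sect_mul_singleton, letter_ofTuple, sect_ofTuple, sect_inv_singleton]
    by_cases h : letter c⁻¹ y = x
    · have hy : letter c x = y := by rw [← h, letter_inv_letter]
      rw [h, hy, Pi.mulSingle_eq_same, Pi.mulSingle_eq_same]
    · have hy : y ≠ letter c x := fun hy => h (letter_inv_of_eq hy.symm)
      rw [Pi.mulSingle_eq_of_ne h, Pi.mulSingle_eq_of_ne hy, mul_one, mul_inv_cancel]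

/-! ### Layer stabilisers -/

theorem mem_layerStab {G : Subgroup (Aut m)} {n : ℕ} {g : Aut m} :
    g ∈ layerStab G n ↔ g ∈ G ∧ g ∈ layerStab (⊤ : Subgroup (Aut m)) n :=
  ⟨fun h => ⟨h.1, trivial, h.2⟩, fun h => ⟨h.1, h.2.2⟩⟩

theorem layerStab_eq_inf (G : Subgroup (Aut m)) (n : ℕ) :
    layerStab G n = G ⊓ layerStab ⊤ n :=
  Subgroup.ext fun _ => mem_layerStab

instance layerStab_top_normal (n : ℕ) : (layerStab (⊤ : Subgroup (Aut m)) n).Normal where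
  conj_mem a ha g := by
    refine ⟨trivial, fun u hu => ?_⟩
    change g.1 (a.1 ((g⁻¹).1 u)) = u
    rw [ha.2 _ (by rw [length_apply, hu])]
    exact Equiv.apply_symm_apply g.1 u

theorem layerStab_conj_mem {G : Subgroup (Aut m)} {n : ℕ} {a g : Aut m} (ha : a ∈ layerStab G n)
    (hg : g ∈ G) : g * a * g⁻¹ ∈ layerStab G n := by
  rw [mem_layerStab] at ha ⊢
  exact ⟨G.mul_mem (G.mul_mem hg ha.1) (G.inv_mem hg),
    (layerStab_top_normal n).conj_mem _ ha.2 g⟩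

theorem mem_layerStab_zero {G : Subgroup (Aut m)} {g : Aut m} (hg : g ∈ G) :
    g ∈ layerStab G 0 := by
  refine ⟨hg, fun u hu => ?_⟩
  rw [List.eq_nil_of_length_eq_zero hu]
  exact List.eq_nil_of_length_eq_zero (length_apply g [])

theorem ofTuple_mem_layerStab_top {y : Fin m → Aut m} {n : ℕ} :
    ofTuple m y ∈ layerStab (⊤ : Subgroup (Aut m)) (n + 1) ↔ ∀ x, y x ∈ layerStab ⊤ n := by
  constructor
  · refine fun h x => ⟨trivial, fun u hu => ?_⟩
    exact (List.cons.inj (h.2 (x :: u) (by simp [hu]))).2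
  · refine fun h => ⟨trivial, fun u hu => ?_⟩
    cases u with
    | nil => simp at hu
    | cons x u =>
      change x :: (y x).1 u = x :: u
      rw [(h x).2 u (by simpa using hu)]

theorem letter_of_mem_layerStab {G : Subgroup (Aut m)} {n : ℕ} {g : Aut m}
    (hg : g ∈ layerStab G (n + 1)) (x : Fin m) : letter g x = x :=
  letter_of_apply_cons (hg.2 (x :: List.replicate n x) (by simp))

theorem sect_mem_layerStab_top {G : Subgroup (Aut m)} {n : ℕ} {g : Aut m}
    (hg : g ∈ layerStab G (n + 1)) (x : Fin m) : sect g [x] ∈ layerStab ⊤ n := by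
  refine ⟨trivial, fun u hu => ?_⟩
  have h := hg.2 (x :: u) (by simp [hu])
  rw [apply_cons] at h
  exact (List.cons.inj h).2

theorem layerStab_antitone [NeZero m] (G : Subgroup (Aut m)) {n k : ℕ} (h : n ≤ k) :
    layerStab G k ≤ layerStab G n := by
  refine fun g hg => ⟨hg.1, fun u hu => ?_⟩
  have h1 := hg.2 (u ++ List.replicate (k - n) 0) (by simp; omega)
  rw [apply_append_eq] at h1
  exact List.append_inj_left h1 (length_apply g u)

/-- The action of an automorphism on the words of length `n`. -/
def layerAction (m n : ℕ) : Aut m →* Equiv.Perm {u : List (Fin m) // u.length = n} where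
  toFun g :=
    { toFun := fun u => ⟨g.1 u.1, by rw [length_apply, u.2]⟩
      invFun := fun u => ⟨(g⁻¹).1 u.1, by rw [length_apply, u.2]⟩
      left_inv := fun u => Subtype.ext (Equiv.symm_apply_apply g.1 u.1)
      right_inv := fun u => Subtype.ext (Equiv.apply_symm_apply g.1 u.1) }
  map_one' := rfl
  map_mul' _ _ := rfl

instance layerStab_top_finiteIndex (n : ℕ) :
    (layerStab (⊤ : Subgroup (Aut m)) n).FiniteIndex := by
  have : Finite {u : List (Fin m) // u.length = n} := inferInstanceAs (Finite (List.Vector _ n))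
  have h : (layerAction m n).ker ≤ layerStab ⊤ n := fun g hg =>
    ⟨trivial, fun u hu => congrArg Subtype.val (Equiv.congr_fun (MonoidHom.mem_ker.1 hg) ⟨u, hu⟩)⟩
  exact Subgroup.finiteIndex_of_le h

/-! ### The homomorphisms `β_i` -/

@[simp] theorem letter_beta_zero (s : ℕ) (g : Aut m) (x : Fin m) :
    letter (beta m s 0 g) x = letter g x := by
  refine letter_of_apply_cons (w := []) (v := []) ?_
  change label g [] x :: _ = _
  simp [label, sect_nil, betaFun]

@[simp] theorem sect_beta_zero (s : ℕ) (g : Aut m) (x : Fin m) :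
    sect (beta m s 0 g) [x] = beta m s (s - 1) (sect g [x]) :=
  sect_of_apply_cons (y := label g [] x) fun _ => rfl

theorem beta_zero_ofTuple (s : ℕ) (y : Fin m → Aut m) :
    beta m s 0 (ofTuple m y) = ofTuple m fun x => beta m s (s - 1) (y x) :=
  eq_ofTuple (by simp) (by simp)

theorem beta_succ [NeZero m] (s i : ℕ) (g : Aut m) :
    beta m s (i + 1) g = ofTuple m (Pi.mulSingle 0 (beta m s i g)) := by
  apply Subtype.ext
  apply Equiv.ext
  rintro (_ | ⟨x, w⟩)
  · rfl
  · change (if (x : ℕ) = 0 then x :: betaFun s i g w else x :: w) = x :: _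
    by_cases hx : x = 0
    · subst hx
      rw [Pi.mulSingle_eq_same, if_pos (by simp)]
      rfl
    · rw [Pi.mulSingle_eq_of_ne hx, if_neg fun h => hx (Fin.ext (by simpa using h))]
      rfl

theorem ofTuple_mulSingle_mem_layerStab_top {x : Fin m} {e : Aut m} {n : ℕ}
    (he : e ∈ layerStab (⊤ : Subgroup (Aut m)) n) :
    ofTuple m (Pi.mulSingle x e) ∈ layerStab (⊤ : Subgroup (Aut m)) (n + 1) := by
  refine ofTuple_mem_layerStab_top.2 fun y => ?_
  by_cases h : y = x
  · subst h
    rwa [Pi.mulSingle_eq_same]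
  · rw [Pi.mulSingle_eq_of_ne h]
    exact one_mem _

/-- Passing from β_i to β_{i+1} adds one trivial level, and β_0 uses up one level of g before
handing over to β_{s-1}. One level of g is thus spread over s levels of its image. -/
theorem beta_mem_layerStab_top [NeZero m] {s : ℕ} (hs : 1 ≤ s) (k : ℕ) : ∀ (i : ℕ) {g : Aut m},
    g ∈ layerStab (⊤ : Subgroup (Aut m)) k → beta m s i g ∈ layerStab ⊤ (s * k + i) := by
  induction k with
  | zero =>
    intro i g _
    induction i with
    | zero => exact mem_layerStab_zero trivial
    | succ i ih => rw [beta_succ]; exact ofTuple_mulSingle_mem_layerStab_top ih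
  | succ k ih =>
    intro i g hg
    induction i with
    | zero =>
      have h := ofTuple_mem_layerStab_top.2 fun x =>
        ih (s - 1) (sect_mem_layerStab_top hg x)
      rw [← beta_zero_ofTuple, ← eq_ofTuple (letter_of_mem_layerStab hg) fun _ => rfl] at h
      rwa [show s * (k + 1) + 0 = s * k + (s - 1) + 1 by rw [mul_add]; omega]
    | succ i ih => rw [beta_succ]; exact ofTuple_mulSingle_mem_layerStab_top ih

end Basilica

namespace Basilica

variable {m s : ℕ} {G : Subgroup (Aut m)}

/-! ### The Basilica group and the normal closure `N_{s-1}` -/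

theorem beta_mem_basilica {i : ℕ} (hi : i < s) {g : Aut m} (hg : g ∈ G) :
    beta m s i g ∈ basilica s G :=
  Subgroup.subset_closure ⟨i, hi, g, hg, rfl⟩

theorem splitN_le_basilica (i : ℕ) : splitN s i G ≤ basilica s G :=
  Subgroup.map_subtype_le _

theorem beta_mem_splitN {i j : ℕ} (hj : j < s) (hji : j ≠ i) {g : Aut m} (hg : g ∈ G) :
    beta m s j g ∈ splitN s i G :=
  ⟨⟨_, beta_mem_basilica hj hg⟩, Subgroup.subset_normalClosure
    (Subgroup.subset_closure ⟨j, hj, hji, g, hg, rfl⟩), rfl⟩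

theorem splitN_conj_mem {i : ℕ} {u b : Aut m} (hu : u ∈ splitN s i G) (hb : b ∈ basilica s G) :
    b * u * b⁻¹ ∈ splitN s i G := by
  obtain ⟨u, hu, rfl⟩ := hu
  exact ⟨⟨b, hb⟩ * u * ⟨b, hb⟩⁻¹, Subgroup.normalClosure_normal.conj_mem u hu _, rfl⟩

theorem splitN_conj_mem' {i : ℕ} {u b : Aut m} (hu : u ∈ splitN s i G) (hb : b ∈ basilica s G) :
    b⁻¹ * u * b ∈ splitN s i G := by
  simpa using splitN_conj_mem hu (inv_mem hb)

theorem splitN_le {i : ℕ} {T : Subgroup (Aut m)}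
    (hT : ∀ b ∈ basilica s G, ∀ t ∈ T, b * t * b⁻¹ ∈ T)
    (h : ∀ j < s, j ≠ i → ∀ g ∈ G, beta m s j g ∈ T) : splitN s i G ≤ T := by
  have hS : splitS s i G ≤ T := by
    rw [splitS, Subgroup.closure_le]
    rintro _ ⟨j, hj, hji, g, hg, rfl⟩
    exact h j hj hji g hg
  rw [splitN, Subgroup.map_le_iff_le_comap]
  have : (T.comap (basilica s G).subtype).Normal := ⟨fun t ht b => hT b b.2 t ht⟩
  exact Subgroup.normalClosure_le_normal fun b hb => hS hb

theorem exists_mem_splitN_mul (hs : 1 ≤ s) {b : Aut m} (hb : b ∈ basilica s G) :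
    ∃ u ∈ splitN s (s - 1) G, ∃ g ∈ G, b = u * beta m s (s - 1) g := by
  induction hb using Subgroup.closure_induction with
  | mem x hx =>
    obtain ⟨i, hi, g, hg, rfl⟩ := hx
    by_cases h : i = s - 1
    · exact ⟨1, one_mem _, g, hg, by rw [h, one_mul]⟩
    · exact ⟨_, beta_mem_splitN hi h hg, 1, one_mem _, by rw [map_one, mul_one]⟩
  | one => exact ⟨1, one_mem _, 1, one_mem _, by rw [map_one, mul_one]⟩
  | mul x y _ _ hx hy =>
    obtain ⟨u, hu, g, hg, rfl⟩ := hx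
    obtain ⟨v, hv, h, hh, rfl⟩ := hy
    have hb := beta_mem_basilica (s := s) (i := s - 1) (by omega) hg
    exact ⟨_, mul_mem hu (splitN_conj_mem hv hb), _, mul_mem hg hh, by rw [map_mul]; group⟩
  | inv x _ hx =>
    obtain ⟨u, hu, g, hg, rfl⟩ := hx
    have hb := beta_mem_basilica (s := s) (i := s - 1) (by omega) hg
    exact ⟨_, splitN_conj_mem' (inv_mem hu) hb, _, inv_mem hg, by rw [map_inv]; group⟩

/-- Up to `N_{s-1}`, the sections of an element of `Bas_s(G)` at the first layer come from an
element of `G` with the same label. -/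
theorem exists_sect_eq [NeZero m] (hs : 1 ≤ s) (hself : SelfSimilar G) {b : Aut m}
    (hb : b ∈ basilica s G) :
    ∃ h ∈ G, (∀ x, letter b x = letter h x) ∧
      ∀ x, ∃ u ∈ splitN s (s - 1) G, sect b [x] = u * beta m s (s - 1) (sect h [x]) := by
  have hB : ∀ {g : Aut m} (x : List (Fin m)), g ∈ G → beta m s (s - 1) (sect g x) ∈ basilica s G :=
    fun x hg => beta_mem_basilica (by omega) (hself _ hg x)
  induction hb using Subgroup.closure_induction with
  | mem b hb =>
    obtain ⟨i, hi, g, hg, rfl⟩ := hb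
    cases i with
    | zero => exact ⟨g, hg, by simp, fun x => ⟨1, one_mem _, by simp⟩⟩
    | succ i =>
      -- The only section of β_{i+1}(g) at a letter that may be nontrivial is β_i(g) with i < s-1, a
      -- generator of N_{s-1}; so the identity of G serves as h.
      refine ⟨1, one_mem _, fun x => by rw [beta_succ, letter_ofTuple, letter_one], fun x => ?_⟩
      refine ⟨_, ?_, by rw [beta_succ, sect_ofTuple, sect_one, map_one, mul_one]⟩
      by_cases hx : x = 0
      · subst hx
        rw [Pi.mulSingle_eq_same]
        exact beta_mem_splitN (by omega) (by omega) hg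
      · rw [Pi.mulSingle_eq_of_ne hx]
        exact one_mem _
  | one => exact ⟨1, one_mem _, fun _ => rfl, fun x => ⟨1, one_mem _, by simp [sect_one]⟩⟩
  | mul a b _ _ ha hb =>
    obtain ⟨g, hg, hg1, hg2⟩ := ha
    obtain ⟨h, hh, hh1, hh2⟩ := hb
    refine ⟨_, mul_mem hg hh, fun x => by rw [letter_mul, letter_mul, hh1, hg1], fun x => ?_⟩
    obtain ⟨u, hu, hu'⟩ := hg2 (letter h x)
    obtain ⟨v, hv, hv'⟩ := hh2 x
    refine ⟨_, mul_mem hu (splitN_conj_mem hv (hB [letter h x] hg)), ?_⟩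
    rw [sect_mul_singleton, sect_mul_singleton, hh1, hu', hv', map_mul]
    group
  | inv a _ ha =>
    obtain ⟨g, hg, hg1, hg2⟩ := ha
    have h1 : ∀ x, letter a⁻¹ x = letter g⁻¹ x := fun x =>
      letter_inv_of_eq (by rw [hg1, letter_inv_letter])
    refine ⟨_, inv_mem hg, h1, fun x => ?_⟩
    obtain ⟨u, hu, hu'⟩ := hg2 (letter g⁻¹ x)
    refine ⟨_, splitN_conj_mem' (inv_mem hu) (hB [letter g⁻¹ x] hg), ?_⟩
    rw [sect_inv_singleton, sect_inv_singleton, h1, hu', map_inv]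
    group

theorem sect_mem_basilica [NeZero m] (hs : 1 ≤ s) (hself : SelfSimilar G) {b : Aut m}
    (hb : b ∈ basilica s G) (x : Fin m) : sect b [x] ∈ basilica s G := by
  obtain ⟨h, hh, -, h2⟩ := exists_sect_eq hs hself hb
  obtain ⟨u, hu, hu'⟩ := h2 x
  rw [hu']
  exact mul_mem (splitN_le_basilica _ hu) (beta_mem_basilica (by omega) (hself _ hh _))

theorem exists_sect_eq_of_fractal {n : ℕ} {g : Aut m} (hfractal : VeryStronglyFractal G)
    (hg : g ∈ layerStab G n) (x : Fin m) : ∃ h ∈ layerStab G (n + 1), sect h [x] = g := by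
  have h : g ∈ (layerStab G n : Set (Aut m)) := hg
  rwa [← hfractal.2 n x] at h

/-- Generators lift one level: β_i(g) with i < s-1 is the section at 0 of β_{i+1}(g), while
β_{s-1}(g) is that of β_0(h), where h ∈ St_G(1) has section g at 0. All lifts fix the letter 0, so
products and inverses lift as well. -/
theorem exists_fixing_sect_eq [NeZero m] (hs : 1 ≤ s) (hfractal : VeryStronglyFractal G)
    {b : Aut m} (hb : b ∈ basilica s G) :
    ∃ c ∈ basilica s G, letter c 0 = 0 ∧ sect c [0] = b := by
  induction hb using Subgroup.closure_induction with
  | mem b hb =>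
    obtain ⟨i, hi, g, hg, rfl⟩ := hb
    by_cases h : i = s - 1
    · obtain ⟨h', hh, hh'⟩ := exists_sect_eq_of_fractal hfractal (mem_layerStab_zero hg) 0
      exact ⟨_, beta_mem_basilica (i := 0) hs hh.1,
        by rw [letter_beta_zero, letter_of_mem_layerStab hh], by rw [sect_beta_zero, hh', h]⟩
    · exact ⟨_, beta_mem_basilica (i := i + 1) (by omega) hg,
        by rw [beta_succ, letter_ofTuple], by rw [beta_succ, sect_ofTuple, Pi.mulSingle_eq_same]⟩
  | one => exact ⟨1, one_mem _, letter_one _, sect_one _⟩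
  | mul a b _ _ ha hb =>
    obtain ⟨c, hc, hc1, hc2⟩ := ha
    obtain ⟨d, hd, hd1, hd2⟩ := hb
    exact ⟨_, mul_mem hc hd, by rw [letter_mul, hd1, hc1],
      by rw [sect_mul_singleton, hd1, hc2, hd2]⟩
  | inv a _ ha =>
    obtain ⟨c, hc, hc1, hc2⟩ := ha
    have h := letter_inv_of_eq hc1
    exact ⟨_, inv_mem hc, h, by rw [sect_inv_singleton, h, hc2]⟩

/-- If `F` and `M` are normalised by `Bas_s(G)` and `(e, 1, …, 1) ∈ M` for all `e ∈ F`, then the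
same holds with `e` placed at any other letter. -/
theorem ofTuple_mulSingle_mem [NeZero m] (hs : 1 ≤ s) (hself : SelfSimilar G)
    (hfractal : VeryStronglyFractal G) {F M : Subgroup (Aut m)}
    (hF : ∀ b ∈ basilica s G, ∀ e ∈ F, b * e * b⁻¹ ∈ F)
    (hM : ∀ b ∈ basilica s G, ∀ e ∈ M, b * e * b⁻¹ ∈ M)
    (h : ∀ e ∈ F, ofTuple m (Pi.mulSingle 0 e) ∈ M) {e : Aut m} (he : e ∈ F) (x : Fin m) :
    ofTuple m (Pi.mulSingle x e) ∈ M := by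
  obtain ⟨t, ht, htx⟩ := hfractal.1 [0] [x] rfl
  rw [apply_singleton] at htx
  have htx : letter t 0 = x := List.singleton_injective htx
  have hb : beta m s (s - 1) (sect t [0]) ∈ basilica s G :=
    beta_mem_basilica (by omega) (hself _ ht _)
  -- Conjugation by β_0(t) moves the entry from 0 to x but also conjugates it by β_{s-1}(t|_0).
  -- Conjugating e by the inverse beforehand cancels this.
  have h1 := hM _ (beta_mem_basilica (i := 0) hs ht) _ (h _ (hF _ (inv_mem hb) _ he))
  rw [conj_ofTuple_mulSingle, letter_beta_zero, sect_beta_zero, htx] at h1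
  convert h1 using 3
  group

theorem ofTuple_mem_of_mulSingle_mem {M : Subgroup (Aut m)} {f : Fin m → Aut m}
    (h : ∀ x, ofTuple m (Pi.mulSingle x (f x)) ∈ M) : ofTuple m f ∈ M := by
  have h1 : f ∈ M.comap (ofTuple m) :=
    Subgroup.pi_mem_of_mulSingle_mem f h
  exact h1

/-- If, modulo the splitting kernel, a tuple consists of the sections of an element of `G`, then
it defines an element of `G`. -/
theorem ofTuple_mem_of_branch (hself : SelfSimilar G)
    (hbranch : WeaklyRegularBranchOver G (splittingKernel s (s - 1) G)) {h : Aut m} (hh : h ∈ G)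
    (hh1 : ∀ x, letter h x = x) {y : Fin m → Aut m} (hy : ∀ x, y x ∈ G)
    (H : ∀ x, beta m s (s - 1) (sect h [x] * (y x)⁻¹) ∈ splitN s (s - 1) G) :
    ofTuple m y ∈ G := by
  obtain ⟨k, hk, hk'⟩ := hbranch.2 (fun x => sect h [x] * (y x)⁻¹) fun x =>
    ⟨Subgroup.mem_map_of_mem _ (mul_mem (hself _ hh _) (inv_mem (hy x))), H x⟩
  have hk1 := letter_of_mem_layerStab hk
  have h1 : k⁻¹ * h = ofTuple m y := by
    refine eq_ofTuple (fun x => ?_) fun x => ?_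
    · rw [letter_mul, hh1, letter_inv_of_eq (hk1 x)]
    · rw [sect_mul_singleton, hh1, sect_inv_singleton, letter_inv_of_eq (hk1 x), hk']
      group
  rw [← h1]
  exact mul_mem (inv_mem (hbranch.1 hk.1)) hh

/-! ### The layer stabilisers of the Basilica group -/

/-- The normal closure in `Bas_s(G)` of those `β_j(St_G(k))` that fix the words of length `n`. -/
def stabClosure (s n : ℕ) (G : Subgroup (Aut m)) : Subgroup (Aut m) :=
  Subgroup.closure {c | ∃ b ∈ basilica s G, ∃ j < s, ∃ k, n ≤ s * k + j ∧
    ∃ g ∈ layerStab G k, c = b * beta m s j g * b⁻¹}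

theorem beta_mem_stabClosure {n j k : ℕ} (hj : j < s) (hk : n ≤ s * k + j) {g : Aut m}
    (hg : g ∈ layerStab G k) : beta m s j g ∈ stabClosure s n G :=
  Subgroup.subset_closure ⟨1, one_mem _, j, hj, k, hk, g, hg, by group⟩

theorem stabClosure_conj_mem {n : ℕ} : ∀ b ∈ basilica s G, ∀ c ∈ stabClosure s n G,
    b * c * b⁻¹ ∈ stabClosure s n G := by
  intro b hb c hc
  induction hc using Subgroup.closure_induction with
  | mem c hc =>
    obtain ⟨a, ha, j, hj, k, hk, g, hg, rfl⟩ := hc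
    exact Subgroup.subset_closure ⟨b * a, mul_mem hb ha, j, hj, k, hk, g, hg, by group⟩
  | one => simp [one_mem]
  | mul c d _ _ hc hd =>
    rw [← conj_mul]
    exact mul_mem hc hd
  | inv c _ hc =>
    rw [← conj_inv]
    exact inv_mem hc

theorem stabClosure_le [NeZero m] (hs : 1 ≤ s) (n : ℕ) :
    stabClosure s n G ≤ layerStab (basilica s G) n := by
  rw [stabClosure, Subgroup.closure_le]
  rintro _ ⟨b, hb, j, hj, k, hk, g, hg, rfl⟩
  refine layerStab_conj_mem (mem_layerStab.2 ⟨beta_mem_basilica hj hg.1, ?_⟩) hb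
  exact layerStab_antitone _ hk (beta_mem_layerStab_top hs k j (mem_layerStab.1 hg).2)

/-- The elements `e` of `N_{s-1}` such that `(e, 1, …, 1)` lies in `stabClosure s (n + 1) G`. -/
def liftable [NeZero m] (s n : ℕ) (G : Subgroup (Aut m)) : Subgroup (Aut m) :=
  splitN s (s - 1) G ⊓
    (stabClosure s (n + 1) G).comap ((ofTuple m).comp (MonoidHom.mulSingle (fun _ => Aut m) 0))

theorem mem_liftable [NeZero m] {n : ℕ} {e : Aut m} : e ∈ liftable s n G ↔
    e ∈ splitN s (s - 1) G ∧ ofTuple m (Pi.mulSingle 0 e) ∈ stabClosure s (n + 1) G := Iff.rfl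

/-- Conjugating the entry at 0 by b amounts to conjugating the whole tuple by a lift of b that fixes
0. -/
theorem comap_mulSingle_conj_mem [NeZero m] (hs : 1 ≤ s) (hfractal : VeryStronglyFractal G)
    {M : Subgroup (Aut m)} (hM : ∀ b ∈ basilica s G, ∀ e ∈ M, b * e * b⁻¹ ∈ M) {b e : Aut m}
    (hb : b ∈ basilica s G) (he : ofTuple m (Pi.mulSingle 0 e) ∈ M) :
    ofTuple m (Pi.mulSingle 0 (b * e * b⁻¹)) ∈ M := by
  obtain ⟨c, hc, hc1, rfl⟩ := exists_fixing_sect_eq hs hfractal hb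
  have h := hM c hc _ he
  rwa [conj_ofTuple_mulSingle, hc1] at h

theorem liftable_conj_mem [NeZero m] (hs : 1 ≤ s) (hfractal : VeryStronglyFractal G) {n : ℕ} :
    ∀ b ∈ basilica s G, ∀ e ∈ liftable s n G, b * e * b⁻¹ ∈ liftable s n G :=
  fun _ hb _ he => ⟨splitN_conj_mem he.1 hb,
    comap_mulSingle_conj_mem hs hfractal stabClosure_conj_mem hb he.2⟩

theorem ofTuple_mulSingle_mem_basilica [NeZero m] (hs : 1 ≤ s) (hfractal : VeryStronglyFractal G)
    {u : Aut m} (hu : u ∈ splitN s (s - 1) G) :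
    ofTuple m (Pi.mulSingle 0 u) ∈ basilica s G := by
  have h : splitN s (s - 1) G ≤ (basilica s G).comap
      ((ofTuple m).comp (MonoidHom.mulSingle (fun _ => Aut m) 0)) := by
    refine splitN_le (fun b hb t ht => ?_) fun j hj hj' g hg => ?_
    · exact comap_mulSingle_conj_mem hs hfractal
        (fun b hb e he => mul_mem (mul_mem hb he) (inv_mem hb)) hb ht
    · change ofTuple m (Pi.mulSingle 0 (beta m s j g)) ∈ basilica s G
      rw [← beta_succ]
      exact beta_mem_basilica (by omega) hg
  exact h hu

theorem ofTuple_mem_stabClosure [NeZero m] (hs : 1 ≤ s) (hself : SelfSimilar G)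
    (hfractal : VeryStronglyFractal G) {n : ℕ} {f : Fin m → Aut m}
    (hf : ∀ x, f x ∈ liftable s n G) : ofTuple m f ∈ stabClosure s (n + 1) G :=
  ofTuple_mem_of_mulSingle_mem fun x => ofTuple_mulSingle_mem hs hself hfractal
    (liftable_conj_mem hs hfractal) stabClosure_conj_mem (fun _ he => he.2) (hf x) x

/-- If h ∈ St_G(⌊n/s⌋+1) has section g at 0, the commutator of (u, 1, …, 1) with β_0(h) is
concentrated at 0 with the required entry. It lies in the closure for n+1 because β_0(h) does and
(u, 1, …, 1) ∈ Bas_s(G). -/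
theorem commutator_mem_liftable [NeZero m] (hs : 1 ≤ s) (hfractal : VeryStronglyFractal G)
    {n : ℕ} {g u : Aut m} (hg : g ∈ layerStab G (n / s)) (hu : u ∈ splitN s (s - 1) G) :
    u * beta m s (s - 1) g * u⁻¹ * (beta m s (s - 1) g)⁻¹ ∈ liftable s n G := by
  have hb := beta_mem_basilica (s := s) (i := s - 1) (by omega) hg.1
  refine mem_liftable.2 ⟨?_, ?_⟩
  · rw [mul_assoc, mul_assoc, ← mul_assoc (beta m s (s - 1) g)]
    exact mul_mem hu (splitN_conj_mem (inv_mem hu) hb)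
  · obtain ⟨h, hh, hh'⟩ := exists_sect_eq_of_fractal hfractal hg 0
    have hn : n + 1 ≤ s * (n / s + 1) + 0 := Nat.lt_mul_div_succ n hs
    have h1 : beta m s 0 h ∈ stabClosure s (n + 1) G := beta_mem_stabClosure hs hn hh
    have h2 := mul_mem (stabClosure_conj_mem _ (ofTuple_mulSingle_mem_basilica hs hfractal hu) _ h1)
      (inv_mem h1)
    have h3 : ofTuple m (Pi.mulSingle 0 (u * beta m s (s - 1) g * u⁻¹ * (beta m s (s - 1) g)⁻¹)) =
        ofTuple m (Pi.mulSingle 0 u) *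
          (beta m s 0 h * ofTuple m (Pi.mulSingle 0 u) * (beta m s 0 h)⁻¹)⁻¹ := by
      rw [conj_ofTuple_mulSingle, letter_beta_zero, letter_of_mem_layerStab hh, sect_beta_zero, hh',
        ← map_inv (ofTuple m), ← map_mul (ofTuple m), ← Pi.mulSingle_inv, ← Pi.mulSingle_mul]
      refine congrArg (fun e => ofTuple m (Pi.mulSingle 0 e)) ?_
      group
    rw [h3]
    convert h2 using 1
    group

theorem beta_conj_mem (hs : 1 ≤ s) {F : Subgroup (Aut m)}
    (hF : ∀ b ∈ basilica s G, ∀ e ∈ F, b * e * b⁻¹ ∈ F) {g f : Aut m} (hg : g ∈ G) (hf : f ∈ F) :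
    (beta m s (s - 1) g)⁻¹ * f * beta m s (s - 1) g ∈ F := by
  simpa using hF _ (inv_mem (beta_mem_basilica (i := s - 1) (by omega) hg)) f hf

theorem exists_of_mem_stabClosure [NeZero m] (hs : 1 ≤ s)
    (hfractal : VeryStronglyFractal G) {n : ℕ} {c : Aut m} (hc : c ∈ stabClosure s n G) :
    ∃ g ∈ layerStab G (n / s), ∃ f ∈ liftable s n G, c = beta m s (s - 1) g * f := by
  have hF : ∀ b ∈ basilica s G, ∀ e ∈ liftable s n G, b * e * b⁻¹ ∈ liftable s n G :=
    liftable_conj_mem hs hfractal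
  induction hc using Subgroup.closure_induction with
  | mem c hc =>
    obtain ⟨b, hb, j, hj, k, hk, g, hg, rfl⟩ := hc
    by_cases h : j = s - 1
    · subst h
      have hg1 : g ∈ layerStab G (n / s) := by
        refine layerStab_antitone G ?_ hg
        rw [← Nat.lt_succ_iff, Nat.div_lt_iff_lt_mul hs, Nat.succ_mul, mul_comm k]
        omega
      obtain ⟨u, hu, h, hh, rfl⟩ := exists_mem_splitN_mul hs hb
      have hg2 := layerStab_conj_mem hg1 hh
      -- The conjugator is uβ_{s-1}(h): the second factor is absorbed by replacing g with its
      -- conjugate by h, and u contributes only a commutator.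
      refine ⟨_, hg2, _, beta_conj_mem hs hF hg2.1 (commutator_mem_liftable hs hfractal hg2 hu), ?_⟩
      simp only [map_mul, map_inv]
      group
    · refine ⟨1, one_mem _, _, hF b hb (beta m s j g) ⟨beta_mem_splitN hj h hg.1, ?_⟩,
        by rw [map_one, one_mul]⟩
      change ofTuple m (Pi.mulSingle 0 (beta m s j g)) ∈ stabClosure s (n + 1) G
      rw [← beta_succ]
      exact beta_mem_stabClosure (k := k) (by omega) (by omega) hg
  | one => exact ⟨1, one_mem _, 1, one_mem _, by rw [map_one, one_mul]⟩
  | mul c d _ _ hc hd =>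
    obtain ⟨g, hg, e, he, rfl⟩ := hc
    obtain ⟨h, hh, f, hf, rfl⟩ := hd
    exact ⟨_, mul_mem hg hh, _, mul_mem (beta_conj_mem hs hF hh.1 he) hf, by rw [map_mul]; group⟩
  | inv c _ hc =>
    obtain ⟨g, hg, f, hf, rfl⟩ := hc
    exact ⟨_, inv_mem hg, _, hF _ (beta_mem_basilica (i := s - 1) (by omega) hg.1) _ (inv_mem hf),
      by rw [map_inv]; group⟩

theorem layerStab_basilica_le [NeZero m] (hs : 1 ≤ s) (hself : SelfSimilar G)
    (hfractal : VeryStronglyFractal G)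
    (hbranch : WeaklyRegularBranchOver G (splittingKernel s (s - 1) G)) (n : ℕ) :
    layerStab (basilica s G) n ≤ stabClosure s n G := by
  induction n with
  | zero =>
    refine fun b hb => (?_ : basilica s G ≤ _) hb.1
    rw [basilica, Subgroup.closure_le]
    rintro _ ⟨i, hi, g, hg, rfl⟩
    exact beta_mem_stabClosure (k := 0) hi (Nat.zero_le _) (mem_layerStab_zero hg)
  | succ n ih =>
    intro b hb
    obtain ⟨h, hh, hh1, hh2⟩ := exists_sect_eq hs hself hb.1
    have hb1 := letter_of_mem_layerStab hb
    have hb2 : ∀ x, sect b [x] ∈ stabClosure s n G := fun x =>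
      ih (mem_layerStab.2 ⟨sect_mem_basilica hs hself hb.1 x, sect_mem_layerStab_top hb x⟩)
    choose u hu hu' using hh2
    choose g hg f hf hgf using fun x => exists_of_mem_stabClosure hs hfractal (hb2 x)
    have hG : ofTuple m g ∈ G := by
      refine ofTuple_mem_of_branch (h := h) hself hbranch hh (fun x => by rw [← hh1, hb1])
        (fun x => (hg x).1) fun x => ?_
      -- The two descriptions of b|_x, namely uβ_{s-1}(h|_x) and β_{s-1}(g_x)f_x, differ by elements
      -- of N_{s-1}, so h|_x and g_x agree modulo K_{s-1}.
      have h1 : beta m s (s - 1) (sect h [x] * (g x)⁻¹) =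
          (u x)⁻¹ * (beta m s (s - 1) (g x) * f x * (beta m s (s - 1) (g x))⁻¹) := by
        rw [← hgf, hu', map_mul, map_inv]
        group
      rw [h1]
      exact mul_mem (inv_mem (hu x))
        (splitN_conj_mem (hf x).1 (beta_mem_basilica (by omega) (hg x).1))
    have h2 : b = beta m s 0 (ofTuple m g) * ofTuple m f := by
      rw [beta_zero_ofTuple, ← map_mul]
      exact eq_ofTuple hb1 hgf
    rw [h2]
    refine mul_mem (beta_mem_stabClosure (k := n / s + 1) hs (Nat.lt_mul_div_succ n hs) ?_)
      (ofTuple_mem_stabClosure hs hself hfractal hf)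
    exact mem_layerStab.2 ⟨hG, ofTuple_mem_layerStab_top.2 fun x => (mem_layerStab.1 (hg x)).2⟩

/-! ### Obstructions as indices -/

theorem relIndex_eq_of_forall_exists {A : Type*} [Group A] {U K L : Subgroup A} (hKL : K ≤ L)
    (h : ∀ v ∈ L, ∃ a ∈ K, a⁻¹ * v ∈ U) : U.relIndex L = U.relIndex K := by
  refine (Nat.card_eq_of_bijective (Subgroup.quotientSubgroupOfEmbeddingOfLE U hKL)
    ⟨(Subgroup.quotientSubgroupOfEmbeddingOfLE U hKL).injective, fun v => ?_⟩).symm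
  induction v using QuotientGroup.induction_on with
  | H v =>
    obtain ⟨a, ha, hav⟩ := h v v.2
    exact ⟨QuotientGroup.mk ⟨a, ha⟩, QuotientGroup.eq.2 hav⟩

/-- The elements of the first layer stabiliser of `Aut(T)` all of whose sections at letters lie in
`St_G(n)`. -/
def stabTuples (G : Subgroup (Aut m)) (n : ℕ) : Subgroup (Aut m) :=
  ((ofTuple m).comp ((layerStab G n).subtype.compLeft (Fin m))).range

theorem mem_stabTuples {n : ℕ} {g : Aut m} : g ∈ stabTuples G n ↔
    ∃ y : Fin m → Aut m, (∀ x, y x ∈ layerStab G n) ∧ ofTuple m y = g :=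
  ⟨fun ⟨y, hy⟩ => ⟨fun x => y x, fun x => (y x).2, hy⟩,
    fun ⟨y, hy, hy'⟩ => ⟨fun x => ⟨y x, hy x⟩, hy'⟩⟩

theorem relIndex_stabTuples (G : Subgroup (Aut m)) (n : ℕ) :
    (layerStab ⊤ (n + 2)).relIndex (stabTuples G n) = Nat.card (layerQuotient G n) ^ m := by
  have h : (layerStab ⊤ (n + 2)).comap ((ofTuple m).comp
      ((layerStab G n).subtype.compLeft (Fin m))) =
      Subgroup.pi Set.univ fun _ => (layerStab G (n + 1)).subgroupOf (layerStab G n) := by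
    ext y
    rw [Subgroup.mem_comap, Subgroup.mem_pi]
    refine (ofTuple_mem_layerStab_top (n := n + 1)).trans (forall_congr' fun x => ?_)
    rw [Subgroup.mem_subgroupOf, mem_layerStab (G := G)]
    exact ⟨fun h _ => ⟨(y x).2.1, h⟩, fun h => (h trivial).2⟩
  rw [stabTuples, ← Subgroup.index_comap, h, Subgroup.index_pi, Finset.prod_const,
    Finset.card_univ, Fintype.card_fin]
  rfl

/-- The subgroup whose index in `stabTuples G n` gives the obstruction. -/
def stabExtended (G : Subgroup (Aut m)) (n : ℕ) : Subgroup (Aut m) :=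
  layerStab G (n + 1) ⊔ layerStab ⊤ (n + 2)

theorem mem_stabExtended {n : ℕ} {g : Aut m} : g ∈ stabExtended G n ↔
    ∃ a ∈ layerStab G (n + 1), ∃ w ∈ layerStab ⊤ (n + 2), a * w = g :=
  Subgroup.mem_sup_of_normal_right

theorem layerStab_succ_le_stabTuples (hself : ∀ g ∈ G, ∀ x : Fin m, sect g [x] ∈ G) (n : ℕ) :
    layerStab G (n + 1) ≤ stabTuples G n := fun g hg =>
  mem_stabTuples.2 ⟨fun x => sect g [x],
    fun x => mem_layerStab.2 ⟨hself g hg.1 x, sect_mem_layerStab_top hg x⟩,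
    (eq_ofTuple (letter_of_mem_layerStab hg) fun _ => rfl).symm⟩

/-- Multiplicativity of the index along St(n+2) ≤ St_G(n+1)·St(n+2) ≤ St_G(n)^m·St(n+2). -/
theorem card_layerQuotient_mul_relIndex [NeZero m] (hself : ∀ g ∈ G, ∀ x : Fin m, sect g [x] ∈ G)
    (n : ℕ) : Nat.card (layerQuotient G (n + 1)) * (stabExtended G n).relIndex (stabTuples G n) =
      Nat.card (layerQuotient G n) ^ m := by
  have h1 : (layerStab ⊤ (n + 2)).relIndex (stabExtended G n) =
      Nat.card (layerQuotient G (n + 1)) := by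
    have h : layerStab ⊤ (n + 2) ⊓ layerStab G (n + 1) = layerStab G (n + 2) := by
      rw [layerStab_eq_inf G (n + 2)]
      exact le_antisymm (fun g hg => ⟨hg.2.1, hg.1⟩) fun g hg =>
        ⟨hg.2, layerStab_antitone G (Nat.le_succ _) (mem_layerStab.2 hg)⟩
    rw [stabExtended, Subgroup.relIndex_sup_right, ← Subgroup.inf_relIndex_right, h]
    rfl
  have h2 : (stabExtended G n).relIndex (stabTuples G n ⊔ layerStab ⊤ (n + 2)) =
      (stabExtended G n).relIndex (stabTuples G n) := by
    refine relIndex_eq_of_forall_exists le_sup_left fun v hv => ?_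
    obtain ⟨a, ha, w, hw, rfl⟩ := Subgroup.mem_sup_of_normal_right.1 hv
    refine ⟨a, ha, ?_⟩
    rw [inv_mul_cancel_left]
    exact (le_sup_right : layerStab ⊤ (n + 2) ≤ stabExtended G n) hw
  have h3 : layerStab ⊤ (n + 2) ≤ stabExtended G n := le_sup_right
  have h4 : stabExtended G n ≤ stabTuples G n ⊔ layerStab ⊤ (n + 2) :=
    sup_le_sup_right (layerStab_succ_le_stabTuples hself n) _
  rw [← h1, ← h2, Subgroup.relIndex_mul_relIndex _ _ _ h3 h4, Subgroup.relIndex_sup_right,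
    relIndex_stabTuples]

/-- Finiteness of the layer quotients, needed since `Nat.card` is 0 on infinite types and the
logarithm of a product splits only for nonzero factors. -/
theorem card_layerQuotient_ne_zero (G : Subgroup (Aut m)) (n : ℕ) :
    Nat.card (layerQuotient G n) ≠ 0 := by
  have h : layerStab ⊤ (n + 1) ⊓ layerStab G n ≤ layerStab G (n + 1) := fun g hg =>
    mem_layerStab.2 ⟨hg.2.1, hg.1⟩
  have h1 : (layerStab ⊤ (n + 1)).relIndex (layerStab G n) ≠ 0 := fun h0 =>
    (layerStab_top_finiteIndex (n + 1)).index_ne_zero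
      (Subgroup.index_eq_zero_of_relIndex_eq_zero h0)
  rw [← Subgroup.inf_relIndex_right] at h1
  exact fun h0 => h1 (Subgroup.relIndex_eq_zero_of_le_left h h0)

theorem obstruction_succ [NeZero m] (hself : ∀ g ∈ G, ∀ x : Fin m, sect g [x] ∈ G) (n : ℕ) :
    obstruction G (n + 1) = Real.logb m ((stabExtended G n).relIndex (stabTuples G n)) := by
  have h := card_layerQuotient_mul_relIndex hself n
  have h1 := card_layerQuotient_ne_zero G (n + 1)
  have h2 : (stabExtended G n).relIndex (stabTuples G n) ≠ 0 := fun h0 => by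
    rw [h0, mul_zero] at h
    exact pow_ne_zero m (card_layerQuotient_ne_zero G n) h.symm
  rw [obstruction, ← Nat.cast_pow, ← h, Nat.cast_mul,
    Real.logb_mul (Nat.cast_ne_zero.2 h1) (Nat.cast_ne_zero.2 h2), add_sub_cancel_left]

/-! ### The series of obstructions of the Basilica group -/

theorem exists_beta_zero_inv_mul_mem [NeZero m] (hs : 1 ≤ s) (hself : SelfSimilar G)
    (hfractal : VeryStronglyFractal G)
    (hbranch : WeaklyRegularBranchOver G (splittingKernel s (s - 1) G)) {n : ℕ} {v : Aut m}
    (hv : v ∈ stabTuples (basilica s G) n) :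
    ∃ a ∈ stabTuples G (n / s), (beta m s 0 a)⁻¹ * v ∈ stabExtended (basilica s G) n := by
  obtain ⟨b, hb, rfl⟩ := mem_stabTuples.1 hv
  choose g hg f hf hgf using fun x => exists_of_mem_stabClosure hs hfractal
    (layerStab_basilica_le hs hself hfractal hbranch n (hb x))
  refine ⟨_, mem_stabTuples.2 ⟨g, hg, rfl⟩, ?_⟩
  have h : ofTuple m b = beta m s 0 (ofTuple m g) * ofTuple m f := by
    rw [beta_zero_ofTuple, ← map_mul]
    exact congrArg _ (funext hgf)
  rw [h, inv_mul_cancel_left]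
  exact (le_sup_left : _ ≤ stabExtended (basilica s G) n)
    (stabClosure_le hs _ (ofTuple_mem_stabClosure hs hself hfractal hf))

theorem beta_zero_mem_of_mem_stabTuples [NeZero m] (hs : 1 ≤ s) {k : ℕ} {a : Aut m}
    (ha : a ∈ stabTuples G k) : beta m s 0 a ∈ layerStab ⊤ (s * (k + 1)) := by
  obtain ⟨g, hg, rfl⟩ := mem_stabTuples.1 ha
  exact beta_mem_layerStab_top hs (k + 1) 0
    (ofTuple_mem_layerStab_top.2 fun x => (mem_layerStab.1 (hg x)).2)

theorem obstruction_basilica_of_not_dvd [NeZero m] (hs : 1 ≤ s) (hself : SelfSimilar G)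
    (hfractal : VeryStronglyFractal G)
    (hbranch : WeaklyRegularBranchOver G (splittingKernel s (s - 1) G)) {n : ℕ}
    (hn : ¬ s ∣ n + 1) : obstruction (basilica s G) (n + 1) = 0 := by
  have h : stabTuples (basilica s G) n ≤ stabExtended (basilica s G) n := fun v hv => by
    obtain ⟨a, ha, hav⟩ := exists_beta_zero_inv_mul_mem hs hself hfractal hbranch hv
    have h1 : n + 2 ≤ s * (n / s + 1) := by
      have h2 : n + 1 ≤ s * (n / s + 1) := Nat.lt_mul_div_succ n hs
      have h3 : n + 1 ≠ s * (n / s + 1) := fun h => hn ⟨_, h⟩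
      omega
    have h4 : beta m s 0 a ∈ stabExtended (basilica s G) n :=
      (le_sup_right : layerStab ⊤ (n + 2) ≤ stabExtended (basilica s G) n)
        (layerStab_antitone _ h1 (beta_zero_mem_of_mem_stabTuples hs ha))
    simpa using mul_mem h4 hav
  rw [obstruction_succ (fun g hg => sect_mem_basilica hs hself hg),
    Subgroup.relIndex_eq_one.2 h, Nat.cast_one, Real.logb_one]

theorem beta_zero_mem_stabExtended_iff [NeZero m] (hs : 1 ≤ s) (hself : SelfSimilar G)
    (hfractal : VeryStronglyFractal G)
    (hbranch : WeaklyRegularBranchOver G (splittingKernel s (s - 1) G)) {k n : ℕ}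
    (hn : n + 1 = s * (k + 1)) {a : Aut m} (ha : a ∈ stabTuples G k) :
    beta m s 0 a ∈ stabExtended (basilica s G) n ↔ a ∈ stabExtended G k := by
  constructor
  · intro h
    obtain ⟨y, hy, rfl⟩ := mem_stabTuples.1 ha
    obtain ⟨b, hb, w, hw, hbw⟩ := mem_stabExtended.1 h
    obtain ⟨h, hh, hh1, hh2⟩ := exists_sect_eq hs hself hb.1
    have hb1 := letter_of_mem_layerStab hb
    have hw1 := letter_of_mem_layerStab hw
    have hβ : ∀ {g}, g ∈ G → beta m s (s - 1) g ∈ basilica s G :=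
      beta_mem_basilica (by omega)
    have hx : ∀ x, sect b [x] * sect w [x] = beta m s (s - 1) (y x) := fun x => by
      have h1 := congrArg (fun g => sect g [x]) hbw
      simpa only [sect_mul_singleton, hw1, sect_beta_zero, sect_ofTuple] using h1
    -- Although w is an arbitrary element of St(n+2), its sections are b|_x⁻¹β_{s-1}(y_x) and so lie
    -- in Bas_s(G).
    have hwx : ∀ x, sect w [x] ∈ stabClosure s (n + 1) G := fun x => by
      refine layerStab_basilica_le hs hself hfractal hbranch (n + 1)
        (mem_layerStab.2 ⟨?_, sect_mem_layerStab_top hw x⟩)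
      rw [eq_inv_mul_of_mul_eq (hx x)]
      exact mul_mem (inv_mem (sect_mem_basilica hs hself hb.1 x)) (hβ (hy x).1)
    choose u hu hu' using hh2
    choose g hg f hf hgf using fun x => exists_of_mem_stabClosure hs hfractal (hwx x)
    have hdiv : (n + 1) / s = k + 1 := by rw [hn, Nat.mul_div_cancel_left _ hs]
    rw [hdiv] at hg
    have hG : ofTuple m (fun x => y x * (g x)⁻¹) ∈ G := by
      refine ofTuple_mem_of_branch (h := h) hself hbranch hh (fun x => by rw [← hh1, hb1])
        (fun x => mul_mem (hy x).1 (inv_mem (hg x).1)) fun x => ?_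
      have h1 : beta m s (s - 1) (sect h [x] * (y x * (g x)⁻¹)⁻¹) = (u x)⁻¹ *
          (beta m s (s - 1) (y x) * (f x)⁻¹ * (beta m s (s - 1) (y x))⁻¹) := by
        have h2 := hx x
        rw [hu', hgf] at h2
        rw [map_mul, map_inv, map_mul, map_inv, ← h2]
        group
      rw [h1]
      exact mul_mem (inv_mem (hu x)) (splitN_conj_mem (inv_mem (hf x).1) (hβ (hy x).1))
    -- Here y = (y g⁻¹)g: the first tuple is in G by branching, and g fixes level k+2 because
    -- (n+1)/s = k+1.
    refine mem_stabExtended.2 ⟨_, mem_layerStab.2 ⟨hG, ofTuple_mem_layerStab_top.2 fun x => ?_⟩,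
      ofTuple m g, ofTuple_mem_layerStab_top.2 fun x => (mem_layerStab.1 (hg x)).2, ?_⟩
    · exact (mem_layerStab.1 (mul_mem (hy x)
        (inv_mem (layerStab_antitone G (Nat.le_succ k) (hg x))))).2
    · rw [← map_mul]
      exact congrArg _ (funext fun x => inv_mul_cancel_right _ _)
  · intro h
    obtain ⟨b, hb, w, hw, rfl⟩ := mem_stabExtended.1 h
    refine mem_stabExtended.2 ⟨_, mem_layerStab.2 ⟨beta_mem_basilica (i := 0) hs hb.1, ?_⟩, _, ?_,
      (map_mul _ _ _).symm⟩
    · rw [hn]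
      exact beta_mem_layerStab_top hs (k + 1) 0 (mem_layerStab.1 hb).2
    · refine layerStab_antitone _ ?_ (beta_mem_layerStab_top hs (k + 2) 0 hw)
      rw [show s * (k + 2) = s * (k + 1) + s by ring, ← hn]
      omega

theorem obstruction_basilica_mul [NeZero m] (hs : 1 ≤ s) (hself : SelfSimilar G)
    (hfractal : VeryStronglyFractal G)
    (hbranch : WeaklyRegularBranchOver G (splittingKernel s (s - 1) G)) (k : ℕ) :
    obstruction (basilica s G) ((k + 1) * s) = obstruction G (k + 1) := by
  obtain ⟨n, hn⟩ : ∃ n, n + 1 = s * (k + 1) :=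
    ⟨s * (k + 1) - 1, Nat.sub_add_cancel (Nat.mul_pos hs k.succ_pos)⟩
  have hdiv : n / s = k := by
    have h : s * (k + 1) = k * s + s := by ring
    rw [Nat.div_eq_iff (by omega)]
    constructor <;> omega
  rw [mul_comm, ← hn, obstruction_succ (fun g hg => sect_mem_basilica hs hself hg),
    obstruction_succ (fun g hg x => hself g hg [x])]
  congr 2
  have hmap : (stabTuples G k).map (beta m s 0) ≤ stabTuples (basilica s G) n := by
    rintro _ ⟨a, ha, rfl⟩
    obtain ⟨g, hg, rfl⟩ := mem_stabTuples.1 ha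
    refine mem_stabTuples.2 ⟨_, fun x => mem_layerStab.2
      ⟨beta_mem_basilica (i := s - 1) (by omega) (hg x).1, ?_⟩, (beta_zero_ofTuple s g).symm⟩
    have h := beta_mem_layerStab_top hs k (s - 1) (mem_layerStab.1 (hg x)).2
    rwa [show s * k + (s - 1) = n by rw [mul_add] at hn; omega] at h
  -- The index for Bas_s(G) can be computed on the image of β_0 and then pulled back to tuples over
  -- G.
  rw [relIndex_eq_of_forall_exists hmap, ← Subgroup.relIndex_comap,
    ← Subgroup.inf_relIndex_right, ← Subgroup.inf_relIndex_right (stabExtended G k)]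
  · congr 1
    ext a
    rw [Subgroup.mem_inf, Subgroup.mem_inf, Subgroup.mem_comap]
    exact and_congr_left (beta_zero_mem_stabExtended_iff hs hself hfractal hbranch hn)
  · intro v hv
    obtain ⟨a, ha, hav⟩ := exists_beta_zero_inv_mul_mem hs hself hfractal hbranch hv
    rw [hdiv] at ha
    exact ⟨_, ⟨a, ha, rfl⟩, hav⟩

end Basilica

theorem mainTheorem5 (m s : ℕ) (hm : 2 ≤ m) (hs : 1 ≤ s)
    (G : Subgroup (Basilica.Aut m)) (hGamma : G ≤ Basilica.Gamma m)
    (hself : Basilica.SelfSimilar G) (hfractal : Basilica.VeryStronglyFractal G)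
    (hbranch : Basilica.WeaklyRegularBranchOver G (Basilica.splittingKernel s (s - 1) G)) :
    (∀ n : ℕ, ¬ s ∣ n → Basilica.obstruction (Basilica.basilica s G) n = 0) ∧
    (∀ q : ℕ, Basilica.obstruction (Basilica.basilica s G) (q * s)
      = Basilica.obstruction G q) := by
  have : NeZero m := ⟨by omega⟩
  refine ⟨fun n hn => ?_, fun q => ?_⟩
  · cases n with
    | zero => exact absurd (dvd_zero s) hn
    | succ n => exact Basilica.obstruction_basilica_of_not_dvd hs hself hfractal hbranch hn
  · cases q with
    | zero => rw [zero_mul]; rfl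
    | succ k => exact Basilica.obstruction_basilica_mul hs hself hfractal hbranch k
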